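/- **Setting.** Let $(\mathcal S,\mathcal A,P,\gamma,\rho)$ be a finite discounted MDP with $S$ states, $A$ actions, $\gamma\in[0,1)$ and initial distribution $\rho$, and let $\phi:\mathcal S\times\mathcal A\to\mathbb R^d$ with $\|\phi(s,a)\|\le 1$ and $r_\omega(s,a)=\omega^\top\phi(s,a)$. For a trajectory $\tau=(s_0,a_0,s_1,\dots)$ put $\phi(\tau)=\sum_{t\ge0}\gamma^t\phi(s_t,a_t)$. A preference dataset is a finite multiset $D$ of triples $(\tau,\tau',o)$ with $o\in\{1,-1\}$; besides genuine trajectories the compared objects may be synthesized responses with an arbitrary feature vector $\phi(\tau)\in\mathbb R^d$ (so for every $z\in\mathbb R^d$ the attacker can produce a pair with $\phi(\tau)-\phi(\tau')=z$), and their return under $r_\omega$ is $\omega^\top\phi(\tau)$. For $\lambda>0$ let $$\ell^\omega(D)=-\sum_{(\tau,\tau',o)\in D}\log\sigma\big(o\,\omega^\top(\phi(\tau)-\phi(\tau'))\big)+\tfrac\lambda2\|\omega\|^2,\qquad \sigma(z)=\frac1{1+e^{-z}} .$$ Unregularized RLHF ($\beta=0$) on $D$ computes $\widehat\omega=\arg\min_\omega\ell^\omega(D)$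 and returns a policy maximizing the value $V^\pi_{r_{\widehat\omega}}(\rho)=\mathbb E[\sum_{t\ge0}\gamma^t r_{\widehat\omega}(s_t,a_t)]$ over all stationary stochastic policies. Let $\pi^\dagger$ be a deterministic policy, $\varepsilon,\varepsilon'>0$, and let $\overline D$ be a dataset of size $\overline n$. A dataset $D$ is a *feasible attack* if every policy $\pi$ that RLHF may return on $\overline D\cup D$ (union of multisets with multiplicities added) satisfies $\|\pi^\dagger-\pi\|_1^2\le\varepsilon$, where $\|\pi-\pi'\|_1=\sum_{s,a}\rho(s)|\pi(a|s)-\pi'(a|s)|$ (and RLHF does return some policy); it is *optimal* if no feasible attack has fewer samples. For $a\ne\pi^\dagger(s)$ let $\pi^\dagger\{s,a\}$ be the policy that plays $a$ in $s$ and agrees with $\pi^\dagger$ elsewhere, and let $M=M_{\pi^\dagger}$ be the $d\times S(A-1)$ matrix with columns $\sum_{s'}d^{\pi^\dagger}_\rho(s')\phi(s',\pi^\dagger(s'))-\sum_{s'}d^{\pi^\dagger\{s,a\}}_\rho(s')\phi(s',\pi^\dagger\{s,a\}(s'))$, where $d^\pi_\rho(s')=(1-\gamma)\sum_{t\ge0}\gamma^t\,\mathbb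 P(s_t=s'\mid s_0\sim\rho,\pi)$. Let $\sigma_{\min}(M)$ be the smallest of its $\min(d,S(A-1))$ singular values. Let $\xi(x)=x/(1+e^x)$, $\xi_{\max}=\max_x\xi(x)$, $x^\star=\arg\max_x\xi(x)$, and for $a\le\xi_{\max}$ let $\xi^{-1}(a)$ be the solution $x\le x^\star$ of $\xi(x)=a$. **Theorem.** Let $\overline\omega$ minimize $\ell^\omega(\overline D)$. Assume that the polytope $\{\omega: M^\top\omega\ge\varepsilon'\mathbf 1\}$ is non-empty, let $\omega^\dagger$ be the Euclidean projection of $\overline\omega$ onto it, and write $\nabla=\nabla_\omega\ell^{\omega^\dagger}(\overline D)$ and $g=(\omega^\dagger)^\top\nabla$. 1. If all constraints are active at $\omega^\dagger$, that is $M^\top\omega^\dagger=\varepsilon'\mathbf 1$, then $\omega^\dagger=\overline\omega+M(M^\top M)^+(\varepsilon'\mathbf 1-M^\top\overline\omega)$. 2. Let $n=\lceil|g|/\xi_{\max}\rceil$ and assume that $g\neq0$ or $\nabla=0$. Then the dataset of $n$ identical samples $(\tau,\tau',1)$ with $$\phi(\tau)-\phi(\tau')=\xi^{-1}\!\Big(\frac{g}{n}\Big)\,\frac{\nabla}{g}$$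 (the empty dataset if $\nabla=0$) is a feasible attack. 3. If $\sigma_{\min}(M)>0$, then there is an optimal attack which consists of $\widehat n$ identical samples, with $$\widehat n\le\left\lceil\frac{2\overline n+\lambda}{\xi_{\max}}\left(\frac{(\varepsilon')^2SA}{\sigma_{\min}^2(M)}+\|\overline\omega\|\,\frac{\varepsilon'\sqrt{SA}}{\sigma_{\min}(M)}\right)\right\rceil .$$ -/

import Mathlib

open scoped InnerProductSpace Matrix

namespace RLHFPoison

noncomputable section

/-- A finite discounted Markov decision process without reward: transition kernel `P`,
initial state distribution `ρ`, discount factor `γ ∈ [0, 1)`. -/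
structure MDP (S A : Type) [Fintype S] [Fintype A] where
  P : S → A → S → ℝ
  P_mem : ∀ s a, P s a ∈ stdSimplex ℝ S
  ρ : S → ℝ
  ρ_mem : ρ ∈ stdSimplex ℝ S
  γ : ℝ
  γ_nonneg : 0 ≤ γ
  γ_lt_one : γ < 1

section Policies

variable {S A : Type} [Fintype S] [Fintype A]

/-- `π` is a (stationary, stochastic) policy; `π s a` is the probability of `a` in state `s`. -/
def IsPolicy (π : S → A → ℝ) : Prop := ∀ s, π s ∈ stdSimplex ℝ A

/-- A deterministic policy viewed as a stochastic one. -/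
def detPolicy [DecidableEq A] (f : S → A) : S → A → ℝ :=
  fun s a => if a = f s then 1 else 0

/-- Law of the state `s_t` when `s_0 ∼ ρ` and actions are drawn from `π`. -/
def stateLaw (m : MDP S A) (π : S → A → ℝ) : ℕ → S → ℝ
  | 0 => m.ρ
  | t + 1 => fun s' => ∑ s, ∑ a, stateLaw m π t s * π s a * m.P s a s'

/-- The value `V^π_r(ρ) = E[∑_t γ^t r(s_t, a_t)]`. -/
def value (m : MDP S A) (r : S → A → ℝ) (π : S → A → ℝ) : ℝ :=
  ∑' t : ℕ, m.γ ^ t * ∑ s, ∑ a, stateLaw m π t s * π s a * r s a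

/-- Normalized discounted state occupancy `d^π_ρ(s) = (1 - γ) ∑_t γ^t ℙ(s_t = s)`. -/
def occupancy (m : MDP S A) (π : S → A → ℝ) (s : S) : ℝ :=
  (1 - m.γ) * ∑' t : ℕ, m.γ ^ t * stateLaw m π t s

/-- `π` maximizes the unregularized objective `V^π_r(ρ)` over all policies. -/
def IsOptimalPolicy (m : MDP S A) (r : S → A → ℝ) (π : S → A → ℝ) : Prop :=
  IsPolicy π ∧ ∀ π' : S → A → ℝ, IsPolicy π' → value m r π' ≤ value m r π

/-- `‖π - π'‖₁ = ∑_{s,a} ρ(s) |π(a|s) - π'(a|s)|`. -/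
def policyDist (m : MDP S A) (π π' : S → A → ℝ) : ℝ :=
  ∑ s, ∑ a, m.ρ s * |π s a - π' s a|

end Policies

section Preferences

/-- The objects compared in a preference dataset: genuine state-action trajectories, and responses
synthesized by the attacker, which are given by their feature vector (the attacker can realize
any feature vector). -/
inductive Item (S A : Type) (d : ℕ)
  | traj (τ : ℕ → S × A)
  | synth (v : EuclideanSpace ℝ (Fin d))

/-- A preference sample `(τ, τ', o)` with label `o ∈ {1, -1}`. -/
structure PrefSample (S A : Type) (d : ℕ) where
  fst : Item S A d
  snd : Item S A d
  o : ℝ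
  ho : o = 1 ∨ o = -1

variable {S A : Type} {d : ℕ}

/-- The linear reward `r_ω(s, a) = ωᵀ φ(s, a)`. -/
def linReward (φ : S → A → EuclideanSpace ℝ (Fin d)) (ω : EuclideanSpace ℝ (Fin d)) :
    S → A → ℝ := fun s a => ⟪ω, φ s a⟫_ℝ

/-- The discounted feature sum `φ(τ) = ∑_t γ^t φ(s_t, a_t)`. -/
def itemFeature (φ : S → A → EuclideanSpace ℝ (Fin d)) (γ : ℝ) :
    Item S A d → EuclideanSpace ℝ (Fin d)
  | .traj τ => ∑' t : ℕ, γ ^ t • φ (τ t).1 (τ t).2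
  | .synth v => v

/-- The discounted return under `r_ω`; for a trajectory it is `∑_t γ^t r_ω(s_t, a_t)`. -/
def itemReturn (φ : S → A → EuclideanSpace ℝ (Fin d)) (γ : ℝ) (ω : EuclideanSpace ℝ (Fin d)) :
    Item S A d → ℝ
  | .traj τ => ∑' t : ℕ, γ ^ t * linReward φ ω (τ t).1 (τ t).2
  | .synth v => ⟪ω, v⟫_ℝ

/-- The regularized negative log-likelihood of the Bradley-Terry model. -/
def loss (φ : S → A → EuclideanSpace ℝ (Fin d)) (γ lam : ℝ) (D : Multiset (PrefSample S A d))
    (ω : EuclideanSpace ℝ (Fin d)) : ℝ :=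
  -(D.map fun p => Real.log
      (Real.sigmoid (p.o * (itemReturn φ γ ω p.fst - itemReturn φ γ ω p.snd)))).sum
    + lam / 2 * ‖ω‖ ^ 2

/-- `ω` is a global minimizer of the reward learning loss. -/
def IsMLE (φ : S → A → EuclideanSpace ℝ (Fin d)) (γ lam : ℝ) (D : Multiset (PrefSample S A d))
    (ω : EuclideanSpace ℝ (Fin d)) : Prop :=
  ∀ ω', loss φ γ lam D ω ≤ loss φ γ lam D ω'

end Preferences

section Attack

variable {S A : Type} [Fintype S] [Fintype A] {d : ℕ}

/-- The policies that unregularized RLHF may return on the dataset `D`: optimal policies for the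
learned reward. -/
def rlhfOutputs (m : MDP S A) (φ : S → A → EuclideanSpace ℝ (Fin d)) (lam : ℝ)
    (D : Multiset (PrefSample S A d)) : Set (S → A → ℝ) :=
  {π | ∃ ω, IsMLE φ m.γ lam D ω ∧ IsOptimalPolicy m (linReward φ ω) π}

/-- Adding `D` to `Dbar` is a successful attack: RLHF has an output, and each of its outputs `π`
satisfies `‖π† - π‖₁² ≤ ε`. -/
def IsFeasible [DecidableEq A] (m : MDP S A) (φ : S → A → EuclideanSpace ℝ (Fin d)) (lam ε : ℝ)
    (target : S → A) (Dbar D : Multiset (PrefSample S A d)) : Prop :=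
  (rlhfOutputs m φ lam (Dbar + D)).Nonempty ∧
    ∀ π ∈ rlhfOutputs m φ lam (Dbar + D), policyDist m (detPolicy target) π ^ 2 ≤ ε

/-- A feasible attack of minimal size. -/
def IsOptimalAttack [DecidableEq A] (m : MDP S A) (φ : S → A → EuclideanSpace ℝ (Fin d))
    (lam ε : ℝ) (target : S → A) (Dbar D : Multiset (PrefSample S A d)) : Prop :=
  IsFeasible m φ lam ε target Dbar D ∧
    ∀ D', IsFeasible m φ lam ε target Dbar D' → D.card ≤ D'.card

/-- Indices `(s, a)`, `a ≠ π†(s)`, of the neighbours of `π†`; there are `S(A-1)` of them. -/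
abbrev NbrIdx (target : S → A) : Type := {p : S × A // p.2 ≠ target p.1}

/-- The average feature vector `∑_s d^π_ρ(s) φ(s, π(s))` of a deterministic policy `π`. -/
def avgFeature [DecidableEq A] (m : MDP S A) (φ : S → A → EuclideanSpace ℝ (Fin d))
    (f : S → A) : EuclideanSpace ℝ (Fin d) :=
  ∑ s, occupancy m (detPolicy f) s • φ s (f s)

/-- The `d × S(A-1)` matrix whose columns are the differences of the average features of `π†` and
of its neighbours `π†{s,a}`. -/
def nbrMatrix [DecidableEq S] [DecidableEq A] (m : MDP S A)
    (φ : S → A → EuclideanSpace ℝ (Fin d)) (target : S → A) :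
    Matrix (Fin d) (NbrIdx target) ℝ :=
  Matrix.of fun k i =>
    (avgFeature m φ target - avgFeature m φ (Function.update target i.1.1 i.1.2)) k

/-- The polytope `{ω : Mᵀ ω ≥ ε'}`. -/
def polytope {ι : Type} (M : Matrix (Fin d) ι ℝ) (ε' : ℝ) : Set (EuclideanSpace ℝ (Fin d)) :=
  {ω | ∀ i, ε' ≤ (Mᵀ *ᵥ ω.ofLp) i}

/-- `p` is the Euclidean projection of `x` onto the set `C`. -/
def IsProjection (C : Set (EuclideanSpace ℝ (Fin d))) (x p : EuclideanSpace ℝ (Fin d)) : Prop :=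
  p ∈ C ∧ ∀ q ∈ C, ‖x - p‖ ≤ ‖x - q‖

/-- The smallest singular value of a `d × k` matrix, i.e. the `min(d, k)`-th largest one
(`singularValues` is indexed from `0` in decreasing order). -/
def sigmaMin {ι : Type} [Fintype ι] [DecidableEq ι] (M : Matrix (Fin d) ι ℝ) : ℝ :=
  (Matrix.toEuclideanLin M).singularValues (min d (Fintype.card ι) - 1)

/-- `G` is the Moore-Penrose pseudoinverse of the real matrix `B`. -/
def IsMoorePenrose {ι κ : Type} [Fintype ι] [Fintype κ] (B : Matrix ι κ ℝ) (G : Matrix κ ι ℝ) :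
    Prop :=
  B * G * B = B ∧ G * B * G = G ∧ (B * G)ᵀ = B * G ∧ (G * B)ᵀ = G * B

end Attack

section Xi

/-- `ξ(x) = x / (1 + exp x)`. -/
def xi (x : ℝ) : ℝ := x / (1 + Real.exp x)

/-- `ξ_max = max_x ξ(x)`. -/
def xiMax : ℝ := ⨆ x, xi x

/-- `x⋆ = argmax_x ξ(x)`. -/
def xStar : ℝ := Classical.epsilon fun x => ∀ y, xi y ≤ xi x

/-- `ξ⁻¹(a)`, the solution of `a = ξ(x)` with `x ≤ x⋆` (for `a ≤ ξ_max`). -/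
def xiInv (a : ℝ) : ℝ := Function.invFunOn xi (Set.Iic xStar) a

end Xi

end

end RLHFPoison

/-! The regularizer makes the loss strongly convex, so its minimizers are exactly the zeros of its
gradient (`isMLE_iff`), and there is at most one (`IsMLE.eq`). Adding k copies of a sample with
signed feature difference z subtracts k σ(-ωᵀz) z from the gradient. With z = c∇ and g = ωᵀ∇ ≠ 0,
cancellation means k ξ(c g) = g, which is solvable as soon as g ≤ k ξ_max. Conversely, if arbitrary
samples z_i cancel ∇, pairing with ω gives g = ∑ ξ(ωᵀz_i) ≤ k ξ_max, so equally many identical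
samples do the same (`exists_replicate_of_lossGrad_eq_zero`).

Positivity of Mᵀω says that the target policy strictly beats each one-state deviation. By the
performance difference identity every other action then has negative advantage, so all optimal
policies agree with the target on the support of ρ, at distance zero
(`isOptimalPolicy_of_forall_update_lt`).

For the size bound, positivity of the margins survives replacing ω† by tω† with t > 0, while the
pairing of tω† with the gradient there tends to 0 as t → 0. Hence one sample always suffices
(`exists_pos_smul_one_sample`), and the claimed bound is the ceiling of a positive number, thus at
least 1. The hypothesis on σ_min enters only through this positivity. -/

namespace RLHFPoison

/-! ### The function ξ: its maximum and its inverse branch. -/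

section XiLemmas

theorem continuous_xi : Continuous xi := by
  unfold xi
  exact continuous_id.div (by fun_prop) fun x => by positivity

theorem xi_eq_mul_sigmoid (x : ℝ) : xi x = x * Real.sigmoid (-x) := by
  simp [xi, Real.sigmoid_def, div_eq_mul_inv]

theorem exists_forall_xi_le : ∃ x, ∀ y, xi y ≤ xi x := by
  obtain ⟨x, -, hx⟩ := (isCompact_Icc (a := (0 : ℝ)) (b := 8)).exists_isMaxOn
    ⟨0, by norm_num⟩ continuous_xi.continuousOn
  have h0 : 0 ≤ xi x := by simpa [xi] using hx (show (0 : ℝ) ∈ Set.Icc 0 8 by norm_num)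
  -- The value at 1 is at least 1/4 because e < 3. Beyond 8, exp y ≥ 1 + y + y²/2 keeps ξ below 1/4,
  -- so the maximum over [0, 8] is global.
  have h1 : 1 / 4 ≤ xi x := by
    refine le_trans ?_ (hx (show (1 : ℝ) ∈ Set.Icc 0 8 by norm_num))
    unfold xi
    gcongr
    linarith [Real.exp_one_lt_d9]
  refine ⟨x, fun y => ?_⟩
  rcases lt_or_ge y 0 with hy | hy
  · exact (div_nonpos_of_nonpos_of_nonneg hy.le (by positivity)).trans h0
  rcases le_or_gt y 8 with hy8 | hy8
  · exact hx ⟨hy, hy8⟩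
  · refine le_trans ?_ h1
    unfold xi
    rw [div_le_div_iff₀ (by positivity) (by norm_num)]
    nlinarith [Real.quadratic_le_exp_of_nonneg hy]

theorem xi_le_xi_xStar (y : ℝ) : xi y ≤ xi xStar :=
  Classical.epsilon_spec exists_forall_xi_le y

theorem xiMax_eq : xiMax = xi xStar :=
  le_antisymm (ciSup_le xi_le_xi_xStar)
    (le_ciSup (f := xi) ⟨xi xStar, by rintro _ ⟨y, rfl⟩; exact xi_le_xi_xStar y⟩ xStar)

theorem xi_le_xiMax (y : ℝ) : xi y ≤ xiMax := xiMax_eq ▸ xi_le_xi_xStar y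

theorem xiMax_pos : 0 < xiMax :=
  lt_of_lt_of_le (show 0 < xi 1 by unfold xi; positivity) (xi_le_xiMax 1)

theorem xStar_pos : 0 < xStar := by
  by_contra! h
  exact absurd xiMax_pos
    (not_lt.2 (xiMax_eq ▸ div_nonpos_of_nonpos_of_nonneg h (by positivity)))

theorem xi_xiInv {a : ℝ} (ha : a ≤ xiMax) : xi (xiInv a) = a := by
  refine Function.invFunOn_eq (s := Set.Iic xStar) ?_
  -- Left endpoint for the intermediate value theorem: on x ≤ 0 the denominator is at most 2, so
  -- ξ(2a) ≤ a for a ≤ 0, and ξ(0) = 0 serves for a ≥ 0.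
  set x₀ := min (2 * a) 0
  have hx₀ : x₀ ≤ 0 := min_le_right _ _
  have hle : xi x₀ ≤ a := by
    unfold xi
    rw [div_le_iff₀ (by positivity)]
    have he : Real.exp x₀ ≤ 1 := Real.exp_le_one_iff.2 hx₀
    have h2 : x₀ ≤ 2 * a := min_le_left _ _
    rcases le_total 0 a with h | h
    · exact hx₀.trans (by positivity)
    · nlinarith
  obtain ⟨x, hx, rfl⟩ := intermediate_value_Icc (hx₀.trans xStar_pos.le)
    continuous_xi.continuousOn ⟨hle, xiMax_eq ▸ ha⟩
  exact ⟨x, hx.2, rfl⟩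

end XiLemmas

/-! ### Convexity of the loss and cancellation of its gradient. -/

section Loss

variable {S A : Type} {d : ℕ}

/-- The signed feature difference `o (φ(τ) - φ(τ'))` of a preference sample. -/
noncomputable def featDiff (φ : S → A → EuclideanSpace ℝ (Fin d)) (γ : ℝ)
    (p : PrefSample S A d) : EuclideanSpace ℝ (Fin d) :=
  p.o • (itemFeature φ γ p.fst - itemFeature φ γ p.snd)

/-- The gradient of the reward learning loss. -/
noncomputable def lossGrad (φ : S → A → EuclideanSpace ℝ (Fin d)) (γ lam : ℝ)
    (D : Multiset (PrefSample S A d)) (ω : EuclideanSpace ℝ (Fin d)) :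
    EuclideanSpace ℝ (Fin d) :=
  lam • ω - (D.map fun p =>
    Real.sigmoid (-⟪ω, featDiff φ γ p⟫_ℝ) • featDiff φ γ p).sum

theorem itemReturn_eq_inner {φ : S → A → EuclideanSpace ℝ (Fin d)} {γ : ℝ}
    (hφ : ∀ s a, ‖φ s a‖ ≤ 1) (h0 : 0 ≤ γ) (h1 : γ < 1)
    (ω : EuclideanSpace ℝ (Fin d)) (i : Item S A d) :
    itemReturn φ γ ω i = ⟪ω, itemFeature φ γ i⟫_ℝ := by
  cases i with
  | synth v => rfl
  | traj τ =>
    have hs : Summable fun t : ℕ => γ ^ t • φ (τ t).1 (τ t).2 := by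
      refine Summable.of_norm_bounded (summable_geometric_of_lt_one h0 h1) fun t => ?_
      rw [norm_smul, Real.norm_of_nonneg (pow_nonneg h0 t)]
      exact mul_le_of_le_one_right (pow_nonneg h0 t) (hφ _ _)
    simpa [itemReturn, itemFeature, linReward, inner_smul_right] using
      ((innerSL ℝ ω).map_tsum hs).symm

theorem loss_eq {φ : S → A → EuclideanSpace ℝ (Fin d)} {γ : ℝ}
    (hφ : ∀ s a, ‖φ s a‖ ≤ 1) (h0 : 0 ≤ γ) (h1 : γ < 1) (lam : ℝ)
    (D : Multiset (PrefSample S A d)) (ω : EuclideanSpace ℝ (Fin d)) :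
    loss φ γ lam D ω =
      (D.map fun p => -Real.log (Real.sigmoid ⟪ω, featDiff φ γ p⟫_ℝ)).sum
        + lam / 2 * ‖ω‖ ^ 2 := by
  simp [loss, itemReturn_eq_inner hφ h0 h1, featDiff, inner_smul_right, inner_sub_right]

/-- The tangent line inequality for the convex function `-log σ`. -/
theorem neg_log_sigmoid_tangent (x y : ℝ) :
    -Real.log (Real.sigmoid x) - Real.sigmoid (-x) * (y - x) ≤
      -Real.log (Real.sigmoid y) := by
  -- Convexity of exp between 0 and x - y with weights σ(x), σ(-x). The weighted mean of the
  -- exponentials collapses to σ(x)/σ(y), and the logarithm gives the claim.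
  have hexp := convexOn_exp.2 (Set.mem_univ 0) (Set.mem_univ (x - y))
    (Real.sigmoid_nonneg x) (Real.sigmoid_nonneg (-x)) (by rw [Real.sigmoid_neg]; ring)
  simp only [smul_eq_mul, mul_zero, zero_add, Real.exp_zero, mul_one] at hexp
  have key : Real.sigmoid x + Real.sigmoid (-x) * Real.exp (x - y) =
      Real.sigmoid x / Real.sigmoid y := by
    rw [← Real.sigmoid_mul_rexp_neg, mul_assoc, ← Real.exp_add, Real.sigmoid_def y,
      div_inv_eq_mul]
    ring_nf
  rw [key] at hexp
  have := Real.log_le_log (Real.exp_pos _) hexp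
  rw [Real.log_exp, Real.log_div (Real.sigmoid_pos x).ne' (Real.sigmoid_pos y).ne'] at this
  linarith

theorem hasDerivAt_neg_log_sigmoid (x : ℝ) :
    HasDerivAt (fun x => -Real.log (Real.sigmoid x)) (-Real.sigmoid (-x)) x := by
  have h := ((Real.hasDerivAt_sigmoid x).log (Real.sigmoid_pos x).ne').neg
  refine h.congr_deriv ?_
  rw [Real.sigmoid_neg, mul_div_cancel_left₀ _ (Real.sigmoid_pos x).ne']

/-- Each likelihood term lies above its tangent line, and the regularizer contributes its exact
quadratic remainder. That remainder makes minimizers unique when λ > 0. -/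
theorem loss_strong_tangent {φ : S → A → EuclideanSpace ℝ (Fin d)} {γ : ℝ}
    (hφ : ∀ s a, ‖φ s a‖ ≤ 1) (h0 : 0 ≤ γ) (h1 : γ < 1) (lam : ℝ)
    (D : Multiset (PrefSample S A d)) (ω ω' : EuclideanSpace ℝ (Fin d)) :
    loss φ γ lam D ω + ⟪lossGrad φ γ lam D ω, ω' - ω⟫_ℝ + lam / 2 * ‖ω' - ω‖ ^ 2 ≤
      loss φ γ lam D ω' := by
  rw [loss_eq hφ h0 h1, loss_eq hφ h0 h1, lossGrad]
  have hsq : ‖ω'‖ ^ 2 = ‖ω‖ ^ 2 + 2 * ⟪ω, ω' - ω⟫_ℝ + ‖ω' - ω‖ ^ 2 := by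
    simpa using norm_add_sq_real ω (ω' - ω)
  rw [hsq, inner_sub_left, real_inner_smul_left]
  induction D using Multiset.induction with
  | empty => simp; linarith
  | cons p D ih =>
    simp only [Multiset.map_cons, Multiset.sum_cons, inner_add_left, real_inner_smul_left] at ih ⊢
    have := neg_log_sigmoid_tangent ⟪ω, featDiff φ γ p⟫_ℝ ⟪ω', featDiff φ γ p⟫_ℝ
    rw [← inner_sub_left, real_inner_comm (featDiff φ γ p) (ω' - ω)] at this
    linarith

theorem hasGradientAt_loss {φ : S → A → EuclideanSpace ℝ (Fin d)} {γ : ℝ}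
    (hφ : ∀ s a, ‖φ s a‖ ≤ 1) (h0 : 0 ≤ γ) (h1 : γ < 1) (lam : ℝ)
    (D : Multiset (PrefSample S A d)) (ω : EuclideanSpace ℝ (Fin d)) :
    HasGradientAt (loss φ γ lam D) (lossGrad φ γ lam D ω) ω := by
  have hf : loss φ γ lam D = _ := funext (loss_eq hφ h0 h1 lam D)
  rw [hasGradientAt_iff_hasFDerivAt, hf]
  induction D using Multiset.induction with
  | empty =>
    have h := ((hasStrictFDerivAt_norm_sq ω).hasFDerivAt).const_mul (lam / 2)
    simp only [Multiset.map_zero, Multiset.sum_zero, zero_add, lossGrad, sub_zero]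
    refine h.congr_fderiv ?_
    ext v
    simp
    ring
  | cons p D ih =>
    have hi : HasFDerivAt (fun ω : EuclideanSpace ℝ (Fin d) => ⟪ω, featDiff φ γ p⟫_ℝ)
        (innerSL ℝ (featDiff φ γ p)) ω := by
      simpa [real_inner_comm] using (innerSL ℝ (featDiff φ γ p)).hasFDerivAt (x := ω)
    have h := ((hasDerivAt_neg_log_sigmoid _).comp_hasFDerivAt ω hi).add
      (ih (funext (loss_eq hφ h0 h1 lam D)))
    refine (h.congr_fderiv ?_).congr_of_eventuallyEq (.of_forall fun x => ?_)
    · ext v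
      simp [lossGrad]
      ring
    · simp [add_assoc]

theorem isMLE_iff {φ : S → A → EuclideanSpace ℝ (Fin d)} {γ lam : ℝ}
    (hφ : ∀ s a, ‖φ s a‖ ≤ 1) (h0 : 0 ≤ γ) (h1 : γ < 1) (hlam : 0 < lam)
    {D : Multiset (PrefSample S A d)} {ω : EuclideanSpace ℝ (Fin d)} :
    IsMLE φ γ lam D ω ↔ lossGrad φ γ lam D ω = 0 := by
  constructor
  · intro h
    have hm : IsLocalMin (loss φ γ lam D) ω := .of_forall h
    have := hm.hasFDerivAt_eq_zero
      (hasGradientAt_iff_hasFDerivAt.1 (hasGradientAt_loss hφ h0 h1 lam D ω))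
    simpa using this
  · intro h ω'
    have := loss_strong_tangent hφ h0 h1 lam D ω ω'
    rw [h, inner_zero_left] at this
    have : 0 ≤ lam / 2 * ‖ω' - ω‖ ^ 2 := by positivity
    linarith

theorem IsMLE.eq {φ : S → A → EuclideanSpace ℝ (Fin d)} {γ lam : ℝ}
    (hφ : ∀ s a, ‖φ s a‖ ≤ 1) (h0 : 0 ≤ γ) (h1 : γ < 1) (hlam : 0 < lam)
    {D : Multiset (PrefSample S A d)} {ω ω' : EuclideanSpace ℝ (Fin d)}
    (h : IsMLE φ γ lam D ω) (h' : IsMLE φ γ lam D ω') : ω' = ω := by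
  have ht := loss_strong_tangent hφ h0 h1 lam D ω ω'
  rw [(isMLE_iff hφ h0 h1 hlam).1 h, inner_zero_left] at ht
  have hn : lam / 2 * ‖ω' - ω‖ ^ 2 ≤ 0 := by linarith [h' ω]
  have : ‖ω' - ω‖ ^ 2 ≤ 0 := by
    by_contra! hc
    exact absurd hn (not_le.2 (by positivity))
  exact sub_eq_zero.1 (norm_eq_zero.1 (pow_eq_zero_iff two_ne_zero |>.1
    (le_antisymm this (by positivity))))

theorem lossGrad_add_replicate (φ : S → A → EuclideanSpace ℝ (Fin d)) (γ lam : ℝ)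
    (D : Multiset (PrefSample S A d)) (k : ℕ) (p : PrefSample S A d)
    (ω : EuclideanSpace ℝ (Fin d)) :
    lossGrad φ γ lam (D + Multiset.replicate k p) ω = lossGrad φ γ lam D ω -
      (k * Real.sigmoid (-⟪ω, featDiff φ γ p⟫_ℝ)) • featDiff φ γ p := by
  simp only [lossGrad, Multiset.map_add, Multiset.sum_add, Multiset.map_replicate,
    Multiset.sum_replicate, mul_smul, ← Nat.cast_smul_eq_nsmul ℝ]
  abel

/-- A sample in the direction of the gradient with the right margin cancels the gradient. -/
theorem lossGrad_add_replicate_eq_zero {φ : S → A → EuclideanSpace ℝ (Fin d)} {γ lam : ℝ}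
    {D : Multiset (PrefSample S A d)} {k : ℕ} (hk : k ≠ 0) {p : PrefSample S A d}
    {ω : EuclideanSpace ℝ (Fin d)}
    (hg : ⟪ω, lossGrad φ γ lam D ω⟫_ℝ ≠ 0)
    (hle : ⟪ω, lossGrad φ γ lam D ω⟫_ℝ / k ≤ xiMax)
    (hp : featDiff φ γ p = (xiInv (⟪ω, lossGrad φ γ lam D ω⟫_ℝ / k) /
      ⟪ω, lossGrad φ γ lam D ω⟫_ℝ) • lossGrad φ γ lam D ω) :
    lossGrad φ γ lam (D + Multiset.replicate k p) ω = 0 := by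
  set g := ⟪ω, lossGrad φ γ lam D ω⟫_ℝ with hgdef
  have hx := xi_xiInv hle
  rw [xi_eq_mul_sigmoid] at hx
  have hin : ⟪ω, featDiff φ γ p⟫_ℝ = xiInv (g / k) := by
    rw [hp, inner_smul_right, ← hgdef, div_mul_cancel₀ _ hg]
  have hk' : (k : ℝ) ≠ 0 := Nat.cast_ne_zero.2 hk
  rw [lossGrad_add_replicate, hin, hp, smul_smul, sub_eq_zero]
  have : k * Real.sigmoid (-xiInv (g / k)) * (xiInv (g / k) / g) = 1 := by
    rw [show k * Real.sigmoid (-xiInv (g / k)) * (xiInv (g / k) / g) =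
      k * (xiInv (g / k) * Real.sigmoid (-xiInv (g / k))) / g by ring, hx]
    field_simp
  rw [this, one_smul]

theorem exists_featDiff_eq (φ : S → A → EuclideanSpace ℝ (Fin d)) (γ : ℝ)
    (z : EuclideanSpace ℝ (Fin d)) : ∃ p : PrefSample S A d, featDiff φ γ p = z :=
  ⟨⟨.synth z, .synth 0, 1, .inl rfl⟩, by simp [featDiff, itemFeature]⟩

/-- Since every feature difference can be synthesized, only a scalar equation along the gradient
remains. An upper bound on the pairing suffices because ξ is unbounded below. -/
theorem exists_replicate_lossGrad_eq_zero (φ : S → A → EuclideanSpace ℝ (Fin d)) (γ lam : ℝ)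
    (D : Multiset (PrefSample S A d)) {k : ℕ} (hk : k ≠ 0) (ω : EuclideanSpace ℝ (Fin d))
    (hle : ⟪ω, lossGrad φ γ lam D ω⟫_ℝ ≤ k * xiMax) :
    ∃ p : PrefSample S A d, lossGrad φ γ lam (D + Multiset.replicate k p) ω = 0 := by
  have hk' : (0 : ℝ) < k := Nat.cast_pos.2 (Nat.pos_of_ne_zero hk)
  by_cases hg : ⟪ω, lossGrad φ γ lam D ω⟫_ℝ = 0
  -- The gradient is orthogonal to ω, so each copy has margin 0 and weight σ(0) = 1/2, whence the
  -- factor 2/k.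
  · obtain ⟨p, hp⟩ := exists_featDiff_eq φ γ ((2 / k : ℝ) • lossGrad φ γ lam D ω)
    refine ⟨p, ?_⟩
    rw [lossGrad_add_replicate, hp, inner_smul_right, hg, mul_zero, neg_zero,
      Real.sigmoid_zero, smul_smul, sub_eq_zero]
    rw [show (k : ℝ) * 2⁻¹ * (2 / k) = 1 by field_simp, one_smul]
  · obtain ⟨p, hp⟩ := exists_featDiff_eq φ γ
      ((xiInv (⟪ω, lossGrad φ γ lam D ω⟫_ℝ / k) / ⟪ω, lossGrad φ γ lam D ω⟫_ℝ) •
        lossGrad φ γ lam D ω)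
    exact ⟨p, lossGrad_add_replicate_eq_zero hk hg (by rwa [div_le_iff₀' hk']) hp⟩

/-- Poisoning samples can be made identical without moving the minimizer. -/
theorem exists_replicate_of_lossGrad_eq_zero (φ : S → A → EuclideanSpace ℝ (Fin d)) (γ lam : ℝ)
    (D D' : Multiset (PrefSample S A d)) (ω : EuclideanSpace ℝ (Fin d))
    (h : lossGrad φ γ lam (D + D') ω = 0) :
    ∃ p : PrefSample S A d,
      lossGrad φ γ lam (D + Multiset.replicate D'.card p) ω = 0 := by
  rcases eq_or_ne D'.card 0 with h0 | h0
  · obtain ⟨p, -⟩ := exists_featDiff_eq φ γ (0 : EuclideanSpace ℝ (Fin d))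
    rw [Multiset.card_eq_zero] at h0
    exact ⟨p, by simpa [h0] using h⟩
  refine exists_replicate_lossGrad_eq_zero φ γ lam D h0 ω ?_
  have hsplit : lossGrad φ γ lam D ω = (D'.map fun p =>
      Real.sigmoid (-⟪ω, featDiff φ γ p⟫_ℝ) • featDiff φ γ p).sum := by
    simp only [lossGrad, Multiset.map_add, Multiset.sum_add] at h ⊢
    rw [← sub_eq_zero, ← h]
    abel
  rw [hsplit]
  clear hsplit h h0
  induction D' using Multiset.induction with
  | empty => simp
  | cons p D' ih =>
    -- Paired with ω, the contribution of a sample is ξ of its margin, so each sample accounts for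
    -- at most ξ_max.
    have := xi_le_xiMax ⟪ω, featDiff φ γ p⟫_ℝ
    rw [xi_eq_mul_sigmoid] at this
    simp only [Multiset.map_cons, Multiset.sum_cons, inner_add_right, inner_smul_right,
      Multiset.card_cons, Nat.cast_add, Nat.cast_one]
    linarith

theorem continuous_lossGrad (φ : S → A → EuclideanSpace ℝ (Fin d)) (γ lam : ℝ)
    (D : Multiset (PrefSample S A d)) : Continuous (lossGrad φ γ lam D) := by
  unfold lossGrad
  refine (continuous_const_smul lam).sub (continuous_multiset_sum _ fun p _ => ?_)
  exact (continuous_sigmoid.comp (by fun_prop)).smul continuous_const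

/-- After shrinking the target reward, which does not change its optimal policies, a single sample
suffices. -/
theorem exists_pos_smul_one_sample (φ : S → A → EuclideanSpace ℝ (Fin d)) (γ lam : ℝ)
    (D : Multiset (PrefSample S A d)) (ω : EuclideanSpace ℝ (Fin d)) :
    ∃ t : ℝ, 0 < t ∧ ∃ p : PrefSample S A d,
      lossGrad φ γ lam (D + Multiset.replicate 1 p) (t • ω) = 0 := by
  have hc : Continuous fun t : ℝ => ⟪t • ω, lossGrad φ γ lam D (t • ω)⟫_ℝ := by
    have h1 : Continuous fun t : ℝ => t • ω := by fun_prop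
    exact h1.inner ((continuous_lossGrad φ γ lam D).comp h1)
  -- The pairing vanishes at t = 0, hence stays below ξ_max for small positive t.
  have hev := hc.continuousAt.eventually_lt (continuousAt_const (y := xiMax) (x := (0 : ℝ)))
    (by simpa using xiMax_pos)
  obtain ⟨t, ht, htpos⟩ :=
    ((hev.filter_mono nhdsWithin_le_nhds).and (self_mem_nhdsWithin (s := Set.Ioi 0))).exists
  obtain ⟨p, hp⟩ := exists_replicate_lossGrad_eq_zero φ γ lam D one_ne_zero (t • ω)
    (by simpa using ht.le)
  exact ⟨t, htpos, p, hp⟩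

end Loss

/-! ### Deterministic policies. -/

section DetPolicy

variable {S A : Type} [Fintype A] [DecidableEq A]

theorem isPolicy_detPolicy (f : S → A) : IsPolicy (detPolicy f) := fun s =>
  ⟨fun a => by unfold detPolicy; split_ifs <;> norm_num, by simp [detPolicy]⟩

theorem sum_detPolicy_mul (f : S → A) (s : S) (c : A → ℝ) :
    ∑ a, detPolicy f s a * c a = c (f s) := by
  simp [detPolicy]

end DetPolicy

/-! ### Performance differences, uniqueness of the target, and feasibility. -/

section Performance

variable {S A : Type} [Fintype S] [Fintype A]

theorem stateLaw_nonneg (m : MDP S A) {π : S → A → ℝ} (hπ : IsPolicy π) (t : ℕ) (s : S) :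
    0 ≤ stateLaw m π t s := by
  induction t generalizing s with
  | zero => exact m.ρ_mem.1 s
  | succ t ih =>
    exact Finset.sum_nonneg fun s' _ => Finset.sum_nonneg fun a _ =>
      mul_nonneg (mul_nonneg (ih s') ((hπ s').1 a)) ((m.P_mem s' a).1 s)

theorem sum_stateLaw_succ_mul (m : MDP S A) (π : S → A → ℝ) (t : ℕ) (V : S → ℝ) :
    ∑ s, stateLaw m π (t + 1) s * V s =
      ∑ s, stateLaw m π t s * ∑ a, π s a * ∑ s', m.P s a s' * V s' := by
  simp only [stateLaw, Finset.sum_mul, Finset.mul_sum]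
  rw [Finset.sum_comm]
  refine Finset.sum_congr rfl fun s _ => ?_
  rw [Finset.sum_comm]
  refine Finset.sum_congr rfl fun a _ => Finset.sum_congr rfl fun s' _ => ?_
  ring

theorem sum_stateLaw (m : MDP S A) {π : S → A → ℝ} (hπ : IsPolicy π) (t : ℕ) :
    ∑ s, stateLaw m π t s = 1 := by
  induction t with
  | zero => exact m.ρ_mem.2
  | succ t ih =>
    have := sum_stateLaw_succ_mul m π t fun _ => 1
    simpa [(m.P_mem _ _).2, (hπ _).2, ih] using this

theorem stateLaw_le_one (m : MDP S A) {π : S → A → ℝ} (hπ : IsPolicy π) (t : ℕ) (s : S) :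
    stateLaw m π t s ≤ 1 := by
  rw [← sum_stateLaw m hπ t]
  exact Finset.single_le_sum (fun s _ => stateLaw_nonneg m hπ t s) (Finset.mem_univ s)

theorem summable_stateLaw (m : MDP S A) {π : S → A → ℝ} (hπ : IsPolicy π) (s : S) :
    Summable fun t : ℕ => m.γ ^ t * stateLaw m π t s := by
  refine Summable.of_nonneg_of_le
    (fun t => mul_nonneg (pow_nonneg m.γ_nonneg t) (stateLaw_nonneg m hπ t s))
    (fun t => mul_le_of_le_one_right (pow_nonneg m.γ_nonneg t) (stateLaw_le_one m hπ t s))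
    (summable_geometric_of_lt_one m.γ_nonneg m.γ_lt_one)

/-- Unnormalized discounted state occupancy. -/
noncomputable def visits (m : MDP S A) (π : S → A → ℝ) (s : S) : ℝ :=
  ∑' t : ℕ, m.γ ^ t * stateLaw m π t s

theorem visits_nonneg (m : MDP S A) {π : S → A → ℝ} (hπ : IsPolicy π) (s : S) :
    0 ≤ visits m π s :=
  tsum_nonneg fun t => mul_nonneg (pow_nonneg m.γ_nonneg t) (stateLaw_nonneg m hπ t s)

/-- The term t = 0 of the series is ρ itself. This keeps the occupancy positive on the support of ρ
under every policy. -/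
theorem rho_le_visits (m : MDP S A) {π : S → A → ℝ} (hπ : IsPolicy π) (s : S) :
    m.ρ s ≤ visits m π s := by
  simpa [stateLaw, visits] using (summable_stateLaw m hπ s).le_tsum 0
    fun t _ => mul_nonneg (pow_nonneg m.γ_nonneg t) (stateLaw_nonneg m hπ t s)

theorem hasSum_stateLaw_mul (m : MDP S A) {π : S → A → ℝ} (hπ : IsPolicy π) (c : S → ℝ) :
    HasSum (fun t : ℕ => m.γ ^ t * ∑ s, stateLaw m π t s * c s)
      (∑ s, visits m π s * c s) := by
  have := hasSum_sum (s := Finset.univ)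
    fun s _ => ((summable_stateLaw m hπ s).hasSum).mul_right (c s)
  simpa [visits, Finset.mul_sum, mul_assoc] using this

theorem value_eq_sum_visits (m : MDP S A) (r : S → A → ℝ) {π : S → A → ℝ} (hπ : IsPolicy π) :
    value m r π = ∑ s, visits m π s * ∑ a, π s a * r s a := by
  rw [← (hasSum_stateLaw_mul m hπ _).tsum_eq, value]
  simp only [Finset.mul_sum, mul_assoc]

/-- The balance equation of the discounted occupancy, tested against `V`. -/
theorem sum_visits_bellman (m : MDP S A) {π : S → A → ℝ} (hπ : IsPolicy π) (V : S → ℝ) :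
    ∑ s, visits m π s * V s = ∑ s, m.ρ s * V s +
      m.γ * ∑ s, visits m π s * ∑ a, π s a * ∑ s', m.P s a s' * V s' := by
  have h := hasSum_stateLaw_mul m hπ V
  -- The term t = 0 gives ρ; in the tail, one transition is moved from the state law onto V.
  rw [← h.tsum_eq, h.summable.tsum_eq_zero_add]
  simp only [sum_stateLaw_succ_mul, pow_succ', mul_assoc, tsum_mul_left]
  rw [(hasSum_stateLaw_mul m hπ _).tsum_eq]
  simp [stateLaw]

/-- The one-step advantage with respect to a function `V` on states. -/
def bellmanGap (m : MDP S A) (r : S → A → ℝ) (V : S → ℝ) (s : S) (a : A) : ℝ :=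
  r s a + m.γ * ∑ s', m.P s a s' * V s' - V s

/-- The performance difference identity. -/
theorem value_eq_add_sum_bellmanGap (m : MDP S A) (r : S → A → ℝ) {π : S → A → ℝ}
    (hπ : IsPolicy π) (V : S → ℝ) :
    value m r π = ∑ s, m.ρ s * V s +
      ∑ s, visits m π s * ∑ a, π s a * bellmanGap m r V s a := by
  have hsplit (s : S) : ∑ a, π s a * bellmanGap m r V s a =
      ∑ a, π s a * r s a + m.γ * ∑ a, π s a * ∑ s', m.P s a s' * V s' - V s := by
    calc _ = ∑ a, (π s a * r s a + m.γ * (π s a * ∑ s', m.P s a s' * V s') - π s a * V s) := by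
          refine Finset.sum_congr rfl fun a _ => ?_
          unfold bellmanGap; ring
      _ = _ := by
          rw [Finset.sum_sub_distrib, Finset.sum_add_distrib, ← Finset.mul_sum,
            ← Finset.sum_mul, (hπ s).2, one_mul]
  have hb := sum_visits_bellman m hπ V
  simp only [hsplit, mul_sub, mul_add, Finset.sum_sub_distrib, Finset.sum_add_distrib]
  rw [value_eq_sum_visits m r hπ, hb, Finset.mul_sum]
  simp only [mul_left_comm m.γ]
  ring

/-- The value function of a deterministic policy, as a solution of its Bellman equation. -/
theorem exists_bellmanGap_eq_zero (m : MDP S A) (r : S → A → ℝ) (f : S → A) :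
    ∃ V : S → ℝ, ∀ s, bellmanGap m r V s (f s) = 0 := by
  let T : (S → ℝ) → S → ℝ := fun V s => r s (f s) + m.γ * ∑ s', m.P s (f s) s' * V s'
  -- Averaging against a transition law does not expand the sup norm, so the Bellman operator
  -- contracts by γ.
  have hT : ContractingWith ⟨m.γ, m.γ_nonneg⟩ T := by
    refine ⟨m.γ_lt_one, LipschitzWith.of_dist_le_mul fun V W => ?_⟩
    refine (dist_pi_le_iff (mul_nonneg m.γ_nonneg dist_nonneg)).2 fun s => ?_
    have : T V s - T W s = m.γ * ∑ s', m.P s (f s) s' * (V s' - W s') := by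
      simp only [T, mul_sub, Finset.sum_sub_distrib]; ring
    rw [Real.dist_eq, this, abs_mul, abs_of_nonneg m.γ_nonneg]
    refine mul_le_mul_of_nonneg_left ?_ m.γ_nonneg
    calc _ ≤ ∑ s', |m.P s (f s) s' * (V s' - W s')| := Finset.abs_sum_le_sum_abs _ _
      _ ≤ ∑ s', m.P s (f s) s' * dist V W := by
          refine Finset.sum_le_sum fun s' _ => ?_
          rw [abs_mul, abs_of_nonneg ((m.P_mem s (f s)).1 s')]
          exact mul_le_mul_of_nonneg_left (dist_le_pi_dist V W s') ((m.P_mem s (f s)).1 s')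
      _ = dist V W := by rw [← Finset.sum_mul, (m.P_mem s (f s)).2, one_mul]
  refine ⟨ContractingWith.fixedPoint T hT, fun s => ?_⟩
  exact sub_eq_zero.2 (congrFun hT.fixedPoint_isFixedPt s)

variable [DecidableEq A]

/-- A deterministic policy that strictly beats all one-state deviations is optimal, and every
optimal policy agrees with it on the support of the initial distribution. -/
theorem isOptimalPolicy_of_forall_update_lt [DecidableEq S] (m : MDP S A) (r : S → A → ℝ)
    (f : S → A)
    (h : ∀ s a, a ≠ f s →
      value m r (detPolicy (Function.update f s a)) < value m r (detPolicy f)) :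
    IsOptimalPolicy m r (detPolicy f) ∧
      ∀ π, IsOptimalPolicy m r π → policyDist m (detPolicy f) π = 0 := by
  obtain ⟨V, hV⟩ := exists_bellmanGap_eq_zero m r f
  have hval : value m r (detPolicy f) = ∑ s, m.ρ s * V s := by
    rw [value_eq_add_sum_bellmanGap m r (isPolicy_detPolicy f) V]
    simp [sum_detPolicy_mul, hV]
  have hneg : ∀ s a, a ≠ f s → bellmanGap m r V s a < 0 := by
    intro s a ha
    have h1 := h s a ha
    rw [hval, value_eq_add_sum_bellmanGap m r (isPolicy_detPolicy _) V] at h1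
    simp only [sum_detPolicy_mul] at h1
    -- The deviation has zero advantage away from s, so its loss of value is the visits to s times
    -- one advantage, which must be negative.
    rw [Finset.sum_eq_single (f := fun s' =>
        visits m (detPolicy (Function.update f s a)) s' *
          bellmanGap m r V s' (Function.update f s a s')) s
      (fun s' _ hs' => by simp [Function.update_of_ne hs', hV]) (by simp),
      Function.update_self] at h1
    by_contra! hc
    have := mul_nonneg
      (visits_nonneg m (isPolicy_detPolicy (Function.update f s a)) s) hc
    linarith
  have hle : ∀ π, IsPolicy π → ∀ s a, π s a * bellmanGap m r V s a ≤ 0 := by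
    intro π hπ s a
    by_cases ha : a = f s
    · simp [ha, hV]
    · exact mul_nonpos_of_nonneg_of_nonpos ((hπ s).1 a) (hneg s a ha).le
  have hterm : ∀ π, IsPolicy π → ∀ s,
      visits m π s * ∑ a, π s a * bellmanGap m r V s a ≤ 0 := fun π hπ s =>
    mul_nonpos_of_nonneg_of_nonpos (visits_nonneg m hπ s)
      (Finset.sum_nonpos fun a _ => hle π hπ s a)
  refine ⟨⟨isPolicy_detPolicy f, fun π hπ => ?_⟩, fun π ⟨hπ, hopt⟩ => ?_⟩
  · rw [hval, value_eq_add_sum_bellmanGap m r hπ V]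
    linarith [Finset.sum_nonpos fun s (_ : s ∈ Finset.univ) => hterm π hπ s]
  · have h1 := hopt _ (isPolicy_detPolicy f)
    rw [hval, value_eq_add_sum_bellmanGap m r hπ V] at h1
    have h0 := (Finset.sum_eq_zero_iff_of_nonpos fun s _ => hterm π hπ s).1
      (le_antisymm (Finset.sum_nonpos fun s _ => hterm π hπ s) (by linarith))
    refine Finset.sum_eq_zero fun s _ => ?_
    -- States of ρ-mass zero do not count in the distance. At the others the occupancy is positive,
    -- so equality of values excludes every action of negative advantage.
    rcases (m.ρ_mem.1 s).eq_or_lt with hρ | hρ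
    · simp [← hρ]
    have hs : ∑ a, π s a * bellmanGap m r V s a = 0 :=
      (mul_eq_zero.1 (h0 s (Finset.mem_univ s))).resolve_left
        (hρ.trans_le (rho_le_visits m hπ s)).ne'
    have hz : ∀ a, a ≠ f s → π s a = 0 := fun a ha =>
      (mul_eq_zero.1 ((Finset.sum_eq_zero_iff_of_nonpos fun a _ => hle π hπ s a).1 hs a
        (Finset.mem_univ a))).resolve_right (hneg s a ha).ne
    have h1 : π s (f s) = 1 := by
      rw [← (hπ s).2, Finset.sum_eq_single (f s) (fun a _ ha => hz a ha) (by simp)]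
    refine Finset.sum_eq_zero fun a _ => ?_
    by_cases ha : a = f s
    · simp [detPolicy, ha, h1]
    · simp [detPolicy, ha, hz a ha]

variable {d : ℕ}

theorem inner_avgFeature (m : MDP S A) (φ : S → A → EuclideanSpace ℝ (Fin d))
    (ω : EuclideanSpace ℝ (Fin d)) (f : S → A) :
    ⟪ω, avgFeature m φ f⟫_ℝ = (1 - m.γ) * value m (linReward φ ω) (detPolicy f) := by
  rw [value_eq_sum_visits m _ (isPolicy_detPolicy f), avgFeature, inner_sum, Finset.mul_sum]
  refine Finset.sum_congr rfl fun s _ => ?_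
  rw [inner_smul_right, sum_detPolicy_mul, linReward, occupancy, visits, mul_assoc]

theorem transpose_nbrMatrix_mulVec [DecidableEq S] (m : MDP S A)
    (φ : S → A → EuclideanSpace ℝ (Fin d)) (target : S → A) (ω : EuclideanSpace ℝ (Fin d))
    (i : NbrIdx target) :
    ((nbrMatrix m φ target)ᵀ *ᵥ ω.ofLp) i = (1 - m.γ) *
      (value m (linReward φ ω) (detPolicy target) -
        value m (linReward φ ω) (detPolicy (Function.update target i.1.1 i.1.2))) := by
  rw [mul_sub, ← inner_avgFeature, ← inner_avgFeature, ← inner_sub_right]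
  simp [Matrix.mulVec, dotProduct, nbrMatrix, PiLp.inner_apply, mul_comm]

/-- If the reward learned from the poisoned data has positive margins, the attack succeeds. -/
theorem isFeasible_of_lossGrad_eq_zero [DecidableEq S] {m : MDP S A}
    {φ : S → A → EuclideanSpace ℝ (Fin d)} (hφ : ∀ s a, ‖φ s a‖ ≤ 1)
    {lam ε : ℝ} (hlam : 0 < lam) (hε : 0 ≤ ε) {target : S → A}
    {Dbar D : Multiset (PrefSample S A d)} {ω : EuclideanSpace ℝ (Fin d)}
    (hω : ∀ i, 0 < ((nbrMatrix m φ target)ᵀ *ᵥ ω.ofLp) i)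
    (hgrad : lossGrad φ m.γ lam (Dbar + D) ω = 0) :
    IsFeasible m φ lam ε target Dbar D := by
  have hmle := (isMLE_iff hφ m.γ_nonneg m.γ_lt_one hlam).2 hgrad
  obtain ⟨hopt, huniq⟩ := isOptimalPolicy_of_forall_update_lt m (linReward φ ω) target
    fun s a ha => by
      have := hω ⟨(s, a), ha⟩
      rw [transpose_nbrMatrix_mulVec] at this
      exact sub_pos.1 (pos_of_mul_pos_right this (sub_nonneg.2 m.γ_lt_one.le))
  refine ⟨⟨_, ω, hmle, hopt⟩, ?_⟩
  rintro π ⟨ω', hω', hπ⟩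
  obtain rfl := hmle.eq hφ m.γ_nonneg m.γ_lt_one hlam hω'
  rw [huniq π hπ]
  simpa using hε

/-- Feasibility depends on the attack only through the minimizer. -/
theorem IsFeasible.of_isMLE {m : MDP S A}
    {φ : S → A → EuclideanSpace ℝ (Fin d)} (hφ : ∀ s a, ‖φ s a‖ ≤ 1)
    {lam ε : ℝ} (hlam : 0 < lam) {target : S → A}
    {Dbar D D' : Multiset (PrefSample S A d)} {ω : EuclideanSpace ℝ (Fin d)}
    (hD : IsMLE φ m.γ lam (Dbar + D) ω) (hD' : IsMLE φ m.γ lam (Dbar + D') ω)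
    (h : IsFeasible m φ lam ε target Dbar D) : IsFeasible m φ lam ε target Dbar D' := by
  have heq : rlhfOutputs m φ lam (Dbar + D) = rlhfOutputs m φ lam (Dbar + D') := by
    ext π
    constructor <;> rintro ⟨ω', hω', hπ⟩
    · obtain rfl := hD.eq hφ m.γ_nonneg m.γ_lt_one hlam hω'
      exact ⟨_, hD', hπ⟩
    · obtain rfl := hD'.eq hφ m.γ_nonneg m.γ_lt_one hlam hω'
      exact ⟨_, hD, hπ⟩
  rwa [IsFeasible, heq] at h

/-- If some attack succeeds, an optimal one consists of identical samples. -/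
theorem exists_isOptimalAttack_replicate {m : MDP S A}
    {φ : S → A → EuclideanSpace ℝ (Fin d)} (hφ : ∀ s a, ‖φ s a‖ ≤ 1)
    {lam ε : ℝ} (hlam : 0 < lam) {target : S → A} {Dbar D : Multiset (PrefSample S A d)}
    (h : IsFeasible m φ lam ε target Dbar D) :
    ∃ k p, IsOptimalAttack m φ lam ε target Dbar (Multiset.replicate k p) := by
  classical
  have hex : ∃ k, ∃ D, IsFeasible m φ lam ε target Dbar D ∧ D.card = k := ⟨_, D, h, rfl⟩
  obtain ⟨D₀, hD₀, hcard⟩ := Nat.find_spec hex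
  -- Feasibility requires an output, and this supplies the minimizer ω without a separate existence
  -- argument.
  obtain ⟨π, ω, hω, -⟩ := hD₀.1
  have hiff {D} := isMLE_iff (D := D) (ω := ω) hφ m.γ_nonneg m.γ_lt_one hlam
  obtain ⟨p, hp⟩ := exists_replicate_of_lossGrad_eq_zero φ m.γ lam Dbar D₀ ω (hiff.1 hω)
  refine ⟨D₀.card, p, hD₀.of_isMLE hφ hlam hω (hiff.2 hp), fun D' hD' => ?_⟩
  rw [Multiset.card_replicate, hcard]
  exact Nat.find_min' hex ⟨D', hD', rfl⟩

end Performance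

/-! ### Projection with all constraints active. -/

section Projection

variable {d : ℕ}

/-- The first Penrose equation gives (MᵀMG - 1)MᵀM = 0, and over ℝ a right factor MᵀM can be
weakened to Mᵀ in such an identity. -/
theorem mul_mul_eq_of_isMoorePenrose {ι κ : Type} [Fintype ι] [Fintype κ] {M : Matrix κ ι ℝ}
    {G : Matrix ι ι ℝ} (hG : IsMoorePenrose (Mᵀ * M) G) : Mᵀ * M * G * Mᵀ = Mᵀ := by
  classical
  have h := (Matrix.mul_conjTranspose_mul_self_eq_zero M (Mᵀ * M * G - 1 : Matrix ι ι ℝ)).1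
  simp only [Matrix.conjTranspose_eq_transpose_of_trivial, Matrix.sub_mul, Matrix.one_mul,
    sub_eq_zero] at h
  exact h hG.1

/-- The correction v lies in the range of M, and p - x - v in the kernel of Mᵀ, so they are
orthogonal. As x + v is feasible, Pythagoras and minimality of p force p - x - v = 0. -/
theorem projection_eq_of_active {ι : Type} [Fintype ι] {M : Matrix (Fin d) ι ℝ} {c : ℝ}
    {x p : EuclideanSpace ℝ (Fin d)} (hp : IsProjection (polytope M c) x p)
    (hact : ∀ i, (Mᵀ *ᵥ p.ofLp) i = c) {G : Matrix ι ι ℝ} (hG : IsMoorePenrose (Mᵀ * M) G) :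
    p = x + WithLp.toLp 2 (M *ᵥ (G *ᵥ ((fun _ => c) - Mᵀ *ᵥ x.ofLp))) := by
  have hMp : Mᵀ *ᵥ p.ofLp = fun _ => c := funext hact
  set y := G *ᵥ ((fun _ => c) - Mᵀ *ᵥ x.ofLp) with hy
  set v : EuclideanSpace ℝ (Fin d) := WithLp.toLp 2 (M *ᵥ y) with hv
  have hMv : Mᵀ *ᵥ v.ofLp = (fun _ => c) - Mᵀ *ᵥ x.ofLp := by
    -- Writing the constant vector as Mᵀp puts the right-hand side in the range of Mᵀ, where MᵀMG
    -- acts as the identity.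
    rw [← hMp, ← Matrix.mulVec_sub] at hy ⊢
    rw [hv, hy]
    simp only [Matrix.mulVec_mulVec, ← Matrix.mul_assoc]
    rw [mul_mul_eq_of_isMoorePenrose hG]
  have horth : ⟪v, (p - x) - v⟫_ℝ = 0 := by
    have : Mᵀ *ᵥ ((p - x) - v).ofLp = 0 := by
      simp only [WithLp.ofLp_sub, Matrix.mulVec_sub, hMp, hMv, sub_self]
    rw [EuclideanSpace.inner_eq_star_dotProduct]
    simp only [star_trivial]
    rw [hv, Matrix.dotProduct_mulVec, ← Matrix.mulVec_transpose, this, zero_dotProduct]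
  have hmem : x + v ∈ polytope M c := fun i => by
    simp [Matrix.mulVec_add, hMv]
  have hle := hp.2 _ hmem
  rw [norm_sub_rev, sub_add_cancel_left, norm_neg] at hle
  have hpyth := norm_add_sq_real v ((p - x) - v)
  rw [horth, add_sub_cancel] at hpyth
  have hsq : ‖p - x‖ ^ 2 ≤ ‖v‖ ^ 2 := by gcongr
  have : ‖p - x - v‖ = 0 := by
    rw [← pow_eq_zero_iff two_ne_zero]
    exact le_antisymm (by linarith) (by positivity)
  rw [norm_eq_zero, sub_sub, sub_eq_zero] at this
  exact this

end Projection

end RLHFPoison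

/-! ### Assembly of the three claims. -/

open RLHFPoison in
theorem theorem1 {S A : Type} [Fintype S] [DecidableEq S] [Fintype A] [DecidableEq A] {d : ℕ}
    (m : RLHFPoison.MDP S A)
    (φ : S → A → EuclideanSpace ℝ (Fin d)) (hφ : ∀ s a, ‖φ s a‖ ≤ 1)
    (lam : ℝ) (hlam : 0 < lam) (ε : ℝ) (hε : 0 < ε) (ε' : ℝ) (hε' : 0 < ε')
    (target : S → A)
    (Dbar : Multiset (RLHFPoison.PrefSample S A d))
    (ωbar : EuclideanSpace ℝ (Fin d)) (hωbar : RLHFPoison.IsMLE φ m.γ lam Dbar ωbar)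
    (M : Matrix (Fin d) (RLHFPoison.NbrIdx target) ℝ) (hM : M = RLHFPoison.nbrMatrix m φ target)
    (ωdag : EuclideanSpace ℝ (Fin d))
    (hωdag : RLHFPoison.IsProjection (RLHFPoison.polytope M ε') ωbar ωdag)
    (grad : EuclideanSpace ℝ (Fin d))
    (hgrad : grad = gradient (RLHFPoison.loss φ m.γ lam Dbar) ωdag)
    (n : ℕ) (hn : n = ⌈|⟪ωdag, grad⟫_ℝ| / RLHFPoison.xiMax⌉₊) :
    -- closed form of the projection when all constraints are active
    ((∀ i, (Mᵀ *ᵥ ωdag.ofLp) i = ε') →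
      ∀ G, RLHFPoison.IsMoorePenrose (Mᵀ * M) G →
        ωdag = ωbar +
          WithLp.toLp 2 (M *ᵥ (G *ᵥ ((fun _ => ε') - Mᵀ *ᵥ ωbar.ofLp)))) ∧
    -- the explicit set of `n` identical samples is a successful attack
    ((grad = 0 ∨ ⟪ωdag, grad⟫_ℝ ≠ 0) →
      ∀ p : RLHFPoison.PrefSample S A d, p.o = 1 →
        RLHFPoison.itemFeature φ m.γ p.fst - RLHFPoison.itemFeature φ m.γ p.snd =
          (RLHFPoison.xiInv (⟪ωdag, grad⟫_ℝ / n) / ⟪ωdag, grad⟫_ℝ) • grad →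
        RLHFPoison.IsFeasible m φ lam ε target Dbar (Multiset.replicate n p)) ∧
    -- the size of an optimal attack
    (0 < RLHFPoison.sigmaMin M →
      ∃ Dhat : Multiset (RLHFPoison.PrefSample S A d),
        RLHFPoison.IsOptimalAttack m φ lam ε target Dbar Dhat ∧
        (∃ p, Dhat = Multiset.replicate Dhat.card p) ∧
        Dhat.card ≤ ⌈(2 * (Dbar.card : ℝ) + lam) / RLHFPoison.xiMax *
          (ε' ^ 2 * (Fintype.card S * Fintype.card A) / RLHFPoison.sigmaMin M ^ 2 +
            ‖ωbar‖ * (ε' * √(Fintype.card S * Fintype.card A) / RLHFPoison.sigmaMin M))⌉₊) := by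
  rw [(hasGradientAt_loss hφ m.γ_nonneg m.γ_lt_one lam Dbar ωdag).gradient] at hgrad
  have hmargin : ∀ i, 0 < ((nbrMatrix m φ target)ᵀ *ᵥ ωdag.ofLp) i := fun i =>
    hε'.trans_le (hM ▸ hωdag.1 i)
  refine ⟨fun hact G hG => projection_eq_of_active hωdag hact hG, fun hg p hpo hp => ?_,
    fun hσ => ?_⟩
  · refine isFeasible_of_lossGrad_eq_zero hφ hlam hε.le hmargin ?_
    rcases hg with hg | hg
    -- With zero gradient the attack is empty, and ω† already minimizes the clean loss.
    · have hn0 : n = 0 := by simp [hn, hg]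
      rw [hn0, Multiset.replicate_zero, add_zero, ← hgrad, hg]
    · have hpos : 0 < |⟪ωdag, grad⟫_ℝ| / xiMax := div_pos (abs_pos.2 hg) xiMax_pos
      have hn0 : n ≠ 0 := by rw [hn]; exact (Nat.ceil_pos.2 hpos).ne'
      have hnpos : (0 : ℝ) < n := Nat.cast_pos.2 (Nat.pos_of_ne_zero hn0)
      have hceil : |⟪ωdag, grad⟫_ℝ| / xiMax ≤ n := hn ▸ Nat.le_ceil _
      rw [div_le_iff₀ xiMax_pos] at hceil
      subst hgrad
      refine lossGrad_add_replicate_eq_zero hn0 hg ?_ ?_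
      · rw [div_le_iff₀' hnpos]
        exact (le_abs_self _).trans hceil
      · rw [featDiff, hpo, one_smul, hp]
  · obtain ⟨t, ht, p, hp⟩ := exists_pos_smul_one_sample φ m.γ lam Dbar ωdag
    have hfeas : IsFeasible m φ lam ε target Dbar (Multiset.replicate 1 p) := by
      refine isFeasible_of_lossGrad_eq_zero hφ hlam hε.le (fun i => ?_) hp
      rw [WithLp.ofLp_smul, Matrix.mulVec_smul]
      exact mul_pos ht (hmargin i)
    obtain ⟨k, q, hopt⟩ := exists_isOptimalAttack_replicate hφ hlam hfeas
    refine ⟨_, hopt, ⟨q, by simp⟩, (hopt.2 _ hfeas).trans ?_⟩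
    -- An optimal attack has at most one sample, so the bound only has to be positive before
    -- rounding up.
    rw [Multiset.card_replicate, Nat.one_le_ceil_iff]
    have hS : Nonempty S := by
      by_contra! hS
      simpa using m.ρ_mem.2
    have hA : Nonempty A := hS.map target
    have := xiMax_pos
    have hcS : (0 : ℝ) < Fintype.card S := Nat.cast_pos.2 Fintype.card_pos
    have hcA : (0 : ℝ) < Fintype.card A := Nat.cast_pos.2 Fintype.card_pos
    positivity
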